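/- Let $\mathbb D$ be the open unit disc and let $b(z)=\frac{1+z}{2}$. Let $\mathscr H(b)$ be the de Branges--Rovnyak space of $b$, i.e. the reproducing kernel Hilbert space of functions on $\mathbb D$ with kernel $$k^b_w(z)=\frac{1-\overline{b(w)}\,b(z)}{1-\overline w z},\qquad z,w\in\mathbb D.$$ For a function $u$ on $\mathbb D$ and an analytic map $\varphi:\mathbb D\to\mathbb D$, put $W_{u,\varphi}f=u\cdot(f\circ\varphi)$ and $C_\varphi f=f\circ\varphi$; such an operator is said to be bounded on $\mathscr H(b)$ if it maps $\mathscr H(b)$ into itself and is bounded there. Say that $\varphi$ has an angular derivative in the sense of Carathéodory at $\zeta\in\partial\mathbb D$ if $\varphi$ and $\varphi'$ both have (finite) non-tangential limits at $\zeta$ and the non-tangential limit $\varphi(\zeta)$ satisfies $|\varphi(\zeta)|=1$. Let $\varphi:\mathbb D\to\mathbb D$ be analytic and suppose that $\varphi$ has non-tangential limit $\varphi(1)=1$ at $1$. Then the following assertions are equivalent. (i) There exists $u\in\mathscr H(b)$ with non-tangential limit $u(1)\neq0$ at $1$ such that $W_{u,\varphi}$ is bounded on $\mathscr H(b)$. (ii)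 $\varphi$ has an angular derivative in the sense of Carathéodory at $1$. (iii) $C_\varphi$ is bounded on $\mathscr H(b)$. -/

import Mathlib

open Complex Filter Topology
open scoped ComplexConjugate UnitDisc

noncomputable section

namespace DeBrangesRovnyak

/-- The de Branges–Rovnyak kernel `k_w(z) = (1 - b(z) conj (b(w))) / (1 - z conj w)` on the open unit
disc, as a matrix whose entry at `(z, w)` is multiplication by `k_w(z)` on `ℂ`. -/
def kernel (b : ℂ → ℂ) : Matrix 𝔻 𝔻 (ℂ →L[ℂ] ℂ) :=
  Matrix.of fun z w : 𝔻 ↦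
    ((1 - b z * conj (b w)) / (1 - (z : ℂ) * conj (w : ℂ))) • ContinuousLinearMap.id ℂ ℂ

/-- The de Branges–Rovnyak space `H(b)`: the reproducing kernel Hilbert space on the unit disc whose
kernel is `kernel b`. Positivity of the kernel amounts to `b` lying in the closed unit ball of
`H^∞`. An element `f` is evaluated at `z : 𝔻` as `f z`. -/
abbrev Space (b : ℂ → ℂ) [Fact (kernel b).PosSemidef] := RKHS.OfKernel (kernel b)

/-- The weighted composition operator `f ↦ u · (f ∘ φ)` is (well defined and) bounded on `H(b)`. -/
def WeightedCompositionBounded (b : ℂ → ℂ) [Fact (kernel b).PosSemidef]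
    (u : 𝔻 → ℂ) (φ : 𝔻 → 𝔻) : Prop :=
  ∃ W : Space b →L[ℂ] Space b, ∀ (f : Space b) (z : 𝔻), W f z = u z * f (φ z)

/-- The composition operator `f ↦ f ∘ φ` is (well defined and) bounded on `H(b)`. -/
def CompositionBounded (b : ℂ → ℂ) [Fact (kernel b).PosSemidef] (φ : 𝔻 → 𝔻) : Prop :=
  ∃ C : Space b →L[ℂ] Space b, ∀ (f : Space b) (z : 𝔻), C f z = f (φ z)

/-- The non-tangential approach region (Stolz region) of aperture `α` at `ζ`; it is empty for
`‖ζ‖ = 1` and `α ≤ 1`. -/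
def stolzRegion (ζ : ℂ) (α : ℝ) : Set 𝔻 := {z | ‖(z : ℂ) - ζ‖ < α * (1 - ‖(z : ℂ)‖)}

/-- `f` has the non-tangential limit `L ∈ ℂ` at the boundary point `ζ`. -/
def HasNontangentialLimit (f : 𝔻 → ℂ) (ζ L : ℂ) : Prop :=
  ∀ α : ℝ, Tendsto f (comap (fun z : 𝔻 ↦ (z : ℂ)) (𝓝 ζ) ⊓ 𝓟 (stolzRegion ζ α)) (𝓝 L)

/-- `φ` has an angular derivative in the sense of Carathéodory at `ζ`: both `φ` and `φ'` have
(finite) non-tangential limits at `ζ`, and the limit of `φ` is unimodular. -/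
def HasAngularDerivative (φ : ℂ → ℂ) (ζ : ℂ) : Prop :=
  (∃ η : ℂ, ‖η‖ = 1 ∧ HasNontangentialLimit (fun z : 𝔻 ↦ φ z) ζ η) ∧
    ∃ d : ℂ, HasNontangentialLimit (fun z : 𝔻 ↦ deriv φ z) ζ d

/-- The self-map of `𝔻` induced by a function on `ℂ` that maps the open unit disc into itself. -/
def selfMap (φ : ℂ → ℂ) (h : Set.MapsTo φ (Metric.ball 0 1) (Metric.ball 0 1)) (z : 𝔻) : 𝔻 :=
  UnitDisc.mk (φ z) (by simpa using h (x := (z : ℂ)) (by simpa using z.norm_lt_one))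

/-- A kernel that is a sum of rank one kernels is positive semidefinite. -/
theorem posSemidef_of_hasSum {X ι : Type*} (k : X → X → ℂ) (ψ : ι → X → ℂ)
    (h : ∀ x y, HasSum (fun n ↦ ψ n x * conj (ψ n y)) (k x y)) :
    (Matrix.of fun x y ↦ k x y • ContinuousLinearMap.id ℂ ℂ).PosSemidef := by
  have key := (RKHS.posSemidef_tfae
    (K := Matrix.of fun x y ↦ k x y • ContinuousLinearMap.id ℂ ℂ)).out 0 2
  refine key.2 ⟨?_, fun v ↦ ?_⟩
  · ext x y
    have hk : conj (k y x) = k x y := by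
      refine HasSum.unique ?_ (h x y)
      have := (h y x).map (starRingEnd ℂ) Complex.continuous_conj
      convert! this using 2
      simp [mul_comm]
    have h1 : star (ContinuousLinearMap.id ℂ ℂ) = ContinuousLinearMap.id ℂ ℂ :=
      star_one (ℂ →L[ℂ] ℂ)
    simp [Matrix.conjTranspose_apply, hk, h1]
  · have hs : HasSum (fun n ↦ (v.sum fun x w ↦ v.sum fun x' w' ↦
        conj (ψ n x' * conj (ψ n x) * w) * w'))
        (v.sum fun x w ↦ v.sum fun x' w' ↦ conj (k x' x * w) * w') := by
      refine hasSum_sum fun x _ ↦ hasSum_sum fun x' _ ↦ ?_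
      refine HasSum.mul_right _ ?_
      exact ((h x' x).mul_right _).map (starRingEnd ℂ) Complex.continuous_conj
    have hn : ∀ n, 0 ≤ (v.sum fun x w ↦ v.sum fun x' w' ↦
        conj (ψ n x' * conj (ψ n x) * w) * w').re := by
      intro n
      have : (v.sum fun x w ↦ v.sum fun x' w' ↦ conj (ψ n x' * conj (ψ n x) * w) * w') =
          (v.sum fun x w ↦ ψ n x * conj w) * conj (v.sum fun x w ↦ ψ n x * conj w) := by
        simp only [Finsupp.sum, map_sum, Finset.sum_mul_sum]
        refine Finset.sum_congr rfl fun x _ ↦ Finset.sum_congr rfl fun y _ ↦ ?_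
        simp only [map_mul, Complex.conj_conj]
        ring
      rw [this, Complex.mul_conj, Complex.ofReal_re]
      exact Complex.normSq_nonneg _
    have hr := (Complex.hasSum_re hs).nonneg hn
    convert! hr using 1
    simp [mul_comm]

/-- The kernel of `H(b)` is positive semidefinite for `b(z) = (1 + z) / 2`. -/
instance fact_posSemidef_half : Fact (kernel fun z ↦ (1 + z) / 2).PosSemidef := by
  refine ⟨posSemidef_of_hasSum (ι := ℕ) _
    (fun n z ↦ Nat.casesOn n ((√2 / 2 : ℝ) : ℂ) fun m ↦ (1 - (z : ℂ)) / 2 * (z : ℂ) ^ m)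
    fun z w ↦ ?_⟩
  have hlt : ‖(z : ℂ) * conj (w : ℂ)‖ < 1 := by
    rw [norm_mul, Complex.norm_conj]
    exact mul_lt_one_of_nonneg_of_lt_one_left (norm_nonneg _) z.norm_lt_one w.norm_lt_one.le
  have hne : 1 - (z : ℂ) * conj (w : ℂ) ≠ 0 := by
    intro h0
    rw [← sub_eq_zero.1 h0] at hlt
    simp at hlt
  have hg := (hasSum_geometric_of_norm_lt_one hlt).mul_left
    ((1 - (z : ℂ)) / 2 * ((1 - conj (w : ℂ)) / 2))
  have h2 : ((√2 / 2 : ℝ) : ℂ) * ((√2 / 2 : ℝ) : ℂ) = 1 / 2 := by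
    rw [← Complex.ofReal_mul, div_mul_div_comm, Real.mul_self_sqrt (by norm_num)]
    norm_num
  have hf := (hasSum_nat_add_iff (f := fun n : ℕ ↦
    (Nat.casesOn n ((√2 / 2 : ℝ) : ℂ) fun m ↦ (1 - (z : ℂ)) / 2 * (z : ℂ) ^ m : ℂ) *
      conj (Nat.casesOn n ((√2 / 2 : ℝ) : ℂ) fun m ↦ (1 - (w : ℂ)) / 2 * (w : ℂ) ^ m : ℂ)) 1
    (g := (1 - (z : ℂ)) / 2 * ((1 - conj (w : ℂ)) / 2) * (1 - (z : ℂ) * conj (w : ℂ))⁻¹)).1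
    (by
      convert! hg using 2 with n
      simp only [map_mul, map_div₀, map_sub, map_one, map_pow, map_ofNat]
      ring)
  convert! hf using 1
  have h3 : ((√2 / 2 : ℝ) : ℂ) * conj ((√2 / 2 : ℝ) : ℂ) = 1 / 2 := by
    rw [Complex.conj_ofReal, h2]
  rw [Finset.sum_range_one]
  refine Eq.trans ?_ (congrArg (_ + ·) h3.symm)
  simp only [map_div₀, map_add, map_one, map_ofNat]
  field_simp
  ring

end DeBrangesRovnyak

end

/-! Write p for the Cayley transform (1+z)/(1-z) and q = p ∘ φ. For this b the kernel is k_w(z) =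
1/2 + (1/2) / (p(z) + conj p(w)), so all three conditions reduce to comparing q with p in the right
half-plane. The link is linear growth, κ(n+1) ≤ |q| at the radial points where p = n+1; Julia's
inequality (`julia`) upgrades it to κ Re p ≤ Re q on the whole disc.

(i) gives growth: the adjoint of W sends k_z to conj u(z) k_{φ(z)}. As z → 1 radially k_z converges
in norm to e = 1/2, an eigenvector of the adjoint, and ‖k_z - e‖² = 1/(4 Re p(z)). Applying the
adjoint to k_z - e bounds |u|² Re p by a multiple of Re q. Julia–Carathéodory then yields (ii).

(ii) gives growth by the mean value inequality. Julia's inequality makes M q - p a function of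
nonnegative real part, so its Pick kernel is positive; multiplying by 1/(q + conj q) shows that M
k_w(z) - k_{φ(w)}(φ(z)) is positive for M ≥ 1 large (`isPosKernel_sub`), which is (iii). Finally
(iii) gives (i) with the constant weight e. -/

noncomputable section

namespace DeBrangesRovnyak

/-! ### Positive scalar kernels -/

/-- A scalar kernel is positive if all the quadratic forms of its finite sections are. -/
def IsPosKernel {X : Type*} (K : X → X → ℂ) : Prop :=
  ∀ (s : Finset X) (c : X → ℂ), 0 ≤ (∑ x ∈ s, ∑ y ∈ s, c x * conj (c y) * K x y).re

namespace IsPosKernel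

variable {X : Type*}

theorem modulate {K : X → X → ℂ} (hK : IsPosKernel K) (g : X → ℂ) :
    IsPosKernel fun x y ↦ g x * conj (g y) * K x y := by
  intro s c
  refine (hK s fun x ↦ c x * g x).trans_eq ?_
  refine congrArg re (Finset.sum_congr rfl fun x _ ↦ Finset.sum_congr rfl fun y _ ↦ ?_)
  simp only [map_mul]
  ring

/-- With `modulate`, this replaces the Schur product theorem when one factor is a sum of rank one
kernels. -/
theorem hasSum {ι : Type*} {Kn : ι → X → X → ℂ} {K : X → X → ℂ} (h : ∀ n, IsPosKernel (Kn n))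
    (hK : ∀ x y, HasSum (fun n ↦ Kn n x y) (K x y)) : IsPosKernel K := by
  intro s c
  have hs : HasSum (fun n ↦ ∑ x ∈ s, ∑ y ∈ s, c x * conj (c y) * Kn n x y)
      (∑ x ∈ s, ∑ y ∈ s, c x * conj (c y) * K x y) :=
    hasSum_sum fun x _ ↦ hasSum_sum fun y _ ↦ (hK x y).mul_left _
  exact (hasSum_re hs).nonneg fun n ↦ h n s c

theorem add {K L : X → X → ℂ} (hK : IsPosKernel K) (hL : IsPosKernel L) :
    IsPosKernel fun x y ↦ K x y + L x y := by
  intro s c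
  simp only [mul_add, Finset.sum_add_distrib, add_re]
  exact add_nonneg (hK s c) (hL s c)

theorem const_nonneg {r : ℝ} (hr : 0 ≤ r) : IsPosKernel fun _ _ : X ↦ (r : ℂ) := by
  intro s c
  have : ∑ x ∈ s, ∑ y ∈ s, c x * conj (c y) * (r : ℂ) =
      ((normSq (∑ x ∈ s, c x) * r : ℝ) : ℂ) := by
    rw [ofReal_mul, ← mul_conj, map_sum, Finset.sum_mul_sum, Finset.sum_mul]
    simp only [Finset.sum_mul]
  rw [this, ofReal_re]
  exact mul_nonneg (normSq_nonneg _) hr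

/-- The Cauchy–Schwarz inequality for positive kernels. -/
theorem normSq_le {K : X → X → ℂ} (hK : IsPosKernel K) (hh : ∀ x y, K y x = conj (K x y))
    (x y : X) : normSq (K x y) ≤ (K x x).re * (K y y).re := by
  classical
  rcases eq_or_ne x y with rfl | hxy
  · have him : (K x x).im = 0 := by
      have := congrArg im (hh x x)
      simp only [conj_im] at this
      linarith
    simp [normSq_apply, him]
  have hy : 0 ≤ (K y y).re := by simpa using hK {y} 1
  have hx : 0 ≤ (K x x).re := by simpa using hK {x} 1
  -- The weight -t conj K(x,y) at x makes the cross terms real. The discriminant gives |K(x,y)|⁴ ≤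
  -- |K(x,y)|² K(x,x) K(y,y), so the case K(x,y) = 0 is separate.
  have key : ∀ t : ℝ, 0 ≤ (normSq (K x y) * (K x x).re) * (t * t) +
      (-2 * normSq (K x y)) * t + (K y y).re := by
    intro t
    have h := hK {x, y} fun w ↦ if w = x then -conj (K x y) * t else 1
    simp only [Finset.sum_pair hxy, if_true, if_neg hxy.symm, hh x y] at h
    refine h.trans_eq ?_
    simp only [normSq_apply, add_re, mul_re, mul_im, neg_re, neg_im, conj_re, conj_im, map_mul,
      map_neg, conj_conj, conj_ofReal, ofReal_re, ofReal_im, map_one, one_re, one_im]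
    ring
  have hd := discrim_le_zero key
  rw [discrim] at hd
  rcases (normSq_nonneg (K x y)).eq_or_lt with h0 | h0
  · rw [← h0]; positivity
  · nlinarith

end IsPosKernel

/-! ### Positivity of the Pick kernel -/

theorem one_sub_mul_conj_ne_zero (z w : 𝔻) : 1 - (z : ℂ) * conj (w : ℂ) ≠ 0 := by
  intro h
  have hlt : ‖(z : ℂ) * conj (w : ℂ)‖ < 1 := by
    rw [norm_mul, Complex.norm_conj]
    exact mul_lt_one_of_nonneg_of_lt_one_left (norm_nonneg _) z.norm_lt_one w.norm_lt_one.le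
  rw [← sub_eq_zero.1 h] at hlt
  simp at hlt

/-- On |ζ| = r, r² = ζ conj ζ turns conj(ζ - w)⁻¹ into ζ / (r² - ζ conj w). What remains is Cauchy's
formula at z for f(ζ) / (r² - ζ conj w). -/
theorem circleAverage_mul_cauchyKernel {f : ℂ → ℂ} (hf : DifferentiableOn ℂ f (Metric.ball 0 1))
    {r : ℝ} (hr0 : 0 < r) (hr1 : r < 1) {z w : ℂ} (hz : ‖z‖ < r) (hw : ‖w‖ < r) :
    Real.circleAverage (fun ζ ↦ f ζ * ((ζ - z)⁻¹ * conj (ζ - w)⁻¹)) 0 r =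
      f z / ((r : ℂ) ^ 2 - z * conj w) := by
  have hne : ∀ ζ : ℂ, ‖ζ‖ ≤ r → (r : ℂ) ^ 2 - ζ * conj w ≠ 0 := by
    intro ζ hζ h
    have h1 : ‖ζ * conj w‖ = r ^ 2 := by
      rw [← sub_eq_zero.1 h]; simp
    rw [norm_mul, norm_conj] at h1
    nlinarith [norm_nonneg ζ, norm_nonneg w]
  have hd : DifferentiableOn ℂ (fun ζ ↦ f ζ / ((r : ℂ) ^ 2 - ζ * conj w))
      (Metric.closedBall 0 r) := by
    refine DifferentiableOn.div (hf.mono (Metric.closedBall_subset_ball hr1)) (by fun_prop) ?_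
    intro ζ hζ
    exact hne ζ (by simpa using hζ)
  have hc := (hd.mono Metric.closure_ball_subset_closedBall).diffContOnCl
  have h2 := DiffContOnCl.circleAverage_smul_div (c := 0) (R := r) (w := z)
    (by rwa [abs_of_pos hr0]) (by simpa [abs_of_pos hr0] using hz)
  rw [← h2]
  refine Real.circleAverage_congr_sphere fun ζ hζ ↦ ?_
  have hn : ‖ζ‖ = r := by simpa [abs_of_pos hr0] using hζ
  have hζz : ζ - z ≠ 0 := by
    intro h
    rw [sub_eq_zero.1 h] at hn
    linarith
  have hcw : conj ζ - conj w ≠ 0 := by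
    rw [← map_sub, Ne, map_eq_zero]
    intro h
    rw [sub_eq_zero.1 h] at hn
    linarith
  have hq := hne ζ hn.le
  have hmul : (r : ℂ) ^ 2 = ζ * conj ζ := by
    rw [mul_conj, normSq_eq_norm_sq, hn]; push_cast; rfl
  rw [hmul] at hq ⊢
  have hζ0 : ζ ≠ 0 := by
    intro h; rw [h, norm_zero] at hn; linarith
  simp only [smul_eq_mul, map_inv₀, map_sub, sub_zero]
  have : ζ * conj ζ - ζ * conj w = ζ * (conj ζ - conj w) := by ring
  rw [this]
  field_simp

/-- The sections at points of `‖z‖ < r` of the kernel `(f + conj f) / (r ^ 2 - z conj w)` are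
positive if `f` is holomorphic with nonnegative real part. -/
theorem sum_pick_nonneg {f : ℂ → ℂ} (hf : DifferentiableOn ℂ f (Metric.ball 0 1))
    (hre : ∀ z ∈ Metric.ball (0 : ℂ) 1, 0 ≤ (f z).re) {r : ℝ} (hr0 : 0 < r) (hr1 : r < 1)
    (s : Finset 𝔻) (hs : ∀ z ∈ s, ‖(z : ℂ)‖ < r) (c : 𝔻 → ℂ) :
    0 ≤ (∑ z ∈ s, ∑ w ∈ s, c z * conj (c w) *
      ((f z + conj (f w)) / ((r : ℂ) ^ 2 - (z : ℂ) * conj (w : ℂ)))).re := by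
  have hnz : ∀ z ∈ s, ∀ ζ ∈ Metric.sphere (0 : ℂ) r, ζ - z ≠ 0 := by
    intro z hz ζ hζ h
    have := hs z hz
    rw [← sub_eq_zero.1 h, mem_sphere_zero_iff_norm.1 hζ] at this
    exact lt_irrefl _ this
  have hfc : ContinuousOn f (Metric.sphere 0 r) :=
    hf.continuousOn.mono (Metric.sphere_subset_closedBall.trans
      (Metric.closedBall_subset_ball hr1))
  have hkc : ∀ z ∈ s, ContinuousOn (fun ζ : ℂ ↦ (ζ - z)⁻¹) (Metric.sphere 0 r) := fun z hz ↦
    ContinuousOn.inv₀ (by fun_prop) (hnz z hz)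
  have hci : ∀ {g : ℂ → ℂ}, ContinuousOn g (Metric.sphere 0 r) → CircleIntegrable g 0 r :=
    fun h ↦ h.circleIntegrable hr0.le
  have hA : ∀ z ∈ s, ∀ w ∈ s, ContinuousOn (fun ζ : ℂ ↦ (ζ - z)⁻¹ * conj (ζ - w)⁻¹)
      (Metric.sphere 0 r) := fun z hz w hw ↦
    (hkc z hz).mul (continuous_conj.comp_continuousOn (hkc w hw))
  have h1 : ∀ z ∈ s, ∀ w ∈ s, ContinuousOn (fun ζ : ℂ ↦ f ζ * ((ζ - z)⁻¹ * conj (ζ - w)⁻¹))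
      (Metric.sphere 0 r) := fun z hz w hw ↦ hfc.mul (hA z hz w hw)
  have h2 : ∀ z ∈ s, ∀ w ∈ s, ContinuousOn
      (fun ζ : ℂ ↦ conj (f ζ * ((ζ - w)⁻¹ * conj (ζ - z)⁻¹))) (Metric.sphere 0 r) :=
    fun z hz w hw ↦ continuous_conj.comp_continuousOn (h1 w hw z hz)
  have hterm : ∀ z ∈ s, ∀ w ∈ s, ContinuousOn (fun ζ : ℂ ↦ c z * conj (c w) *
      (f ζ * ((ζ - z)⁻¹ * conj (ζ - w)⁻¹) + conj (f ζ * ((ζ - w)⁻¹ * conj (ζ - z)⁻¹))))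
      (Metric.sphere 0 r) := fun z hz w hw ↦
    continuousOn_const.mul ((h1 z hz w hw).add (h2 z hz w hw))
  have hF : ContinuousOn (fun ζ : ℂ ↦ ∑ z ∈ s, ∑ w ∈ s, c z * conj (c w) *
      (f ζ * ((ζ - z)⁻¹ * conj (ζ - w)⁻¹) + conj (f ζ * ((ζ - w)⁻¹ * conj (ζ - z)⁻¹))))
      (Metric.sphere 0 r) :=
    continuousOn_finsetSum _ fun z hz ↦ continuousOn_finsetSum _ fun w hw ↦ hterm z hz w hw
  have havg : Real.circleAverage (fun ζ : ℂ ↦ ∑ z ∈ s, ∑ w ∈ s, c z * conj (c w) *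
      (f ζ * ((ζ - z)⁻¹ * conj (ζ - w)⁻¹) + conj (f ζ * ((ζ - w)⁻¹ * conj (ζ - z)⁻¹)))) 0 r =
      ∑ z ∈ s, ∑ w ∈ s, c z * conj (c w) *
      ((f z + conj (f w)) / ((r : ℂ) ^ 2 - (z : ℂ) * conj (w : ℂ))) := by
    rw [Real.circleAverage_fun_sum fun z hz ↦ hci
      (continuousOn_finsetSum _ fun w hw ↦ hterm z hz w hw)]
    refine Finset.sum_congr rfl fun z hz ↦ ?_
    rw [Real.circleAverage_fun_sum fun w hw ↦ hci (hterm z hz w hw)]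
    refine Finset.sum_congr rfl fun w hw ↦ ?_
    have e1 := circleAverage_mul_cauchyKernel hf hr0 hr1 (hs z hz) (hs w hw)
    have e2 := circleAverage_mul_cauchyKernel hf hr0 hr1 (hs w hw) (hs z hz)
    have e3 := (conjCLE : ℂ →L[ℝ] ℂ).circleAverage_comp_comm (hci (h1 w hw z hz))
    rw [e2] at e3
    have e4 := Real.circleAverage_fun_smul (c := 0) (R := r) (a := c z * conj (c w)) (f := fun ζ ↦
      f ζ * ((ζ - z)⁻¹ * conj (ζ - w)⁻¹) + conj (f ζ * ((ζ - w)⁻¹ * conj (ζ - z)⁻¹)))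
    simp only [smul_eq_mul] at e4
    rw [e4, Real.circleAverage_fun_add (hci (h1 z hz w hw)) (hci (h2 z hz w hw)), e1]
    have e5 : Real.circleAverage (fun ζ ↦ conj (f ζ * ((ζ - (w : ℂ))⁻¹ * conj (ζ - (z : ℂ))⁻¹))) 0 r
        = conj (f w / ((r : ℂ) ^ 2 - (w : ℂ) * conj (z : ℂ))) := e3
    rw [e5]
    simp only [map_div₀, map_sub, map_pow, conj_ofReal, map_mul, conj_conj]
    rw [mul_comm (conj (w : ℂ)) (z : ℂ), add_div]
  rw [← havg]
  have hre2 := Complex.reCLM.circleAverage_comp_comm (hci hF)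
  rw [reCLM_apply] at hre2
  rw [← hre2]
  refine Real.circleAverage_nonneg_of_nonneg fun ζ hζ ↦ ?_
  rw [abs_of_pos hr0] at hζ
  -- On the circle the integrand is 2 Re f(ζ) |∑ c_z / (ζ - z)|², hence nonnegative.
  have : ∑ z ∈ s, ∑ w ∈ s, c z * conj (c w) *
      (f ζ * ((ζ - z)⁻¹ * conj (ζ - w)⁻¹) + conj (f ζ * ((ζ - w)⁻¹ * conj (ζ - z)⁻¹))) =
      ((2 * (f ζ).re * normSq (∑ z ∈ s, c z * (ζ - z)⁻¹) : ℝ) : ℂ) := by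
    rw [ofReal_mul, ← mul_conj, map_sum, Finset.sum_mul_sum, Finset.mul_sum]
    refine Finset.sum_congr rfl fun z _ ↦ ?_
    rw [Finset.mul_sum]
    refine Finset.sum_congr rfl fun w _ ↦ ?_
    rw [← add_conj]
    simp only [map_mul, conj_conj]
    ring
  simp only [Function.comp_apply, reCLM_apply]
  rw [this, ofReal_re]
  have := hre ζ (by rw [mem_ball_zero_iff, mem_sphere_zero_iff_norm.1 hζ]; exact hr1)
  exact mul_nonneg (by linarith) (normSq_nonneg _)

/-- The Pick kernel of a holomorphic function with nonnegative real part is positive. -/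
theorem isPosKernel_pick {f : ℂ → ℂ} (hf : DifferentiableOn ℂ f (Metric.ball 0 1))
    (hre : ∀ z ∈ Metric.ball (0 : ℂ) 1, 0 ≤ (f z).re) :
    IsPosKernel fun z w : 𝔻 ↦ (f z + conj (f w)) / (1 - (z : ℂ) * conj (w : ℂ)) := by
  intro s c
  -- f need not extend to the unit circle, so circles of radius r < 1 are used and r → 1.
  have ht : Tendsto (fun r : ℝ ↦ (∑ z ∈ s, ∑ w ∈ s, c z * conj (c w) *
      ((f z + conj (f w)) / ((r : ℂ) ^ 2 - (z : ℂ) * conj (w : ℂ)))).re) (𝓝[<] 1)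
      (𝓝 (∑ z ∈ s, ∑ w ∈ s, c z * conj (c w) *
      ((f z + conj (f w)) / (1 - (z : ℂ) * conj (w : ℂ)))).re) := by
    refine (continuous_re.tendsto _).comp
      (tendsto_finsetSum _ fun z _ ↦ tendsto_finsetSum _ fun w _ ↦ Tendsto.const_mul _ ?_)
    refine Tendsto.div tendsto_const_nhds (Tendsto.mono_left ?_ nhdsWithin_le_nhds)
      (one_sub_mul_conj_ne_zero z w)
    have : Continuous fun r : ℝ ↦ (r : ℂ) ^ 2 - (z : ℂ) * conj (w : ℂ) := by fun_prop
    simpa using this.tendsto 1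
  have hev : ∀ᶠ r : ℝ in 𝓝[<] 1, 0 < r ∧ r < 1 ∧ ∀ z ∈ s, ‖(z : ℂ)‖ < r := by
    have h1 : ∀ᶠ r : ℝ in 𝓝 1, 0 < r := lt_mem_nhds one_pos
    have h2 : ∀ᶠ r : ℝ in 𝓝 1, ∀ z ∈ s, ‖(z : ℂ)‖ < r :=
      (Filter.eventually_all_finset s).2 fun z _ ↦ lt_mem_nhds z.norm_lt_one
    filter_upwards [nhdsWithin_le_nhds h1, nhdsWithin_le_nhds h2, self_mem_nhdsWithin]
      with r a b d using ⟨a, d, b⟩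
  refine ge_of_tendsto ht (hev.mono fun r ⟨h0, h1, hs⟩ ↦ ?_)
  exact sum_pick_nonneg hf hre h0 h1 s hs c

/-! ### Half-plane coordinates and Schwarz–Pick -/

/-- The Cayley transform of the unit disc onto the right half-plane. -/
def cayley (z : ℂ) : ℂ := (1 + z) / (1 - z)

theorem one_sub_ne_zero (z : 𝔻) : 1 - (z : ℂ) ≠ 0 := sub_ne_zero.2 z.coe_ne_one.symm

theorem one_sub_conj_ne_zero (z : 𝔻) : 1 - conj (z : ℂ) ≠ 0 := by
  rw [← map_one (starRingEnd ℂ), ← map_sub, Ne, map_eq_zero]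
  exact one_sub_ne_zero z

theorem cayley_add_conj (z w : 𝔻) : cayley z + conj (cayley w) =
    2 * (1 - (z : ℂ) * conj (w : ℂ)) / ((1 - z) * (1 - conj (w : ℂ))) := by
  have h1 := one_sub_ne_zero z
  have h2 := one_sub_conj_ne_zero w
  simp only [cayley, map_div₀, map_add, map_sub, map_one]
  field_simp
  ring

theorem cayley_add_conj_ne_zero (z w : 𝔻) : cayley z + conj (cayley w) ≠ 0 := by
  rw [cayley_add_conj]
  exact div_ne_zero (mul_ne_zero two_ne_zero (one_sub_mul_conj_ne_zero z w))
    (mul_ne_zero (one_sub_ne_zero z) (one_sub_conj_ne_zero w))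

theorem cayley_re (z : 𝔻) : (cayley z).re = (1 - ‖(z : ℂ)‖ ^ 2) / ‖1 - (z : ℂ)‖ ^ 2 := by
  have h := cayley_add_conj z z
  rw [add_conj, mul_conj, normSq_eq_norm_sq] at h
  have h2 : (1 - (z : ℂ)) * (1 - conj (z : ℂ)) = ((‖1 - (z : ℂ)‖ ^ 2 : ℝ) : ℂ) := by
    rw [← normSq_eq_norm_sq, ← mul_conj, map_sub, map_one]
  rw [h2] at h
  have h3 : 2 * (cayley z).re = 2 * (1 - ‖(z : ℂ)‖ ^ 2) / ‖1 - (z : ℂ)‖ ^ 2 := by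
    exact_mod_cast h
  rw [mul_div_assoc] at h3
  linarith

theorem cayley_re_pos (z : 𝔻) : 0 < (cayley z).re := by
  rw [cayley_re]
  have := z.sq_norm_lt_one
  have := norm_pos_iff.2 (one_sub_ne_zero z)
  apply div_pos <;> [linarith; positivity]

theorem cayley_ne_zero (z : 𝔻) : cayley z ≠ 0 := fun h ↦ by
  simpa [h] using cayley_re_pos z

theorem isPosKernel_pick_cayley {f : ℂ → ℂ} (hf : DifferentiableOn ℂ f (Metric.ball 0 1))
    (hre : ∀ z ∈ Metric.ball (0 : ℂ) 1, 0 ≤ (f z).re) :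
    IsPosKernel fun z w : 𝔻 ↦ (f z + conj (f w)) / (cayley z + conj (cayley w)) := by
  -- The two denominators differ by g(z) conj g(w) with g(z) = (1 - z)/√2, which preserves
  -- positivity.
  have h := (isPosKernel_pick hf hre).modulate fun z : 𝔻 ↦ (1 - (z : ℂ)) * ((√2 / 2 : ℝ) : ℂ)
  convert h using 3 with z w
  have h2 : ((√2 / 2 : ℝ) : ℂ) * ((√2 / 2 : ℝ) : ℂ) = 1 / 2 := by
    rw [← ofReal_mul, div_mul_div_comm, Real.mul_self_sqrt (by norm_num)]
    norm_num
  have e : (1 - (z : ℂ)) * ((√2 / 2 : ℝ) : ℂ) * conj ((1 - (w : ℂ)) * ((√2 / 2 : ℝ) : ℂ)) =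
      (1 - z) * (1 - conj (w : ℂ)) / 2 := by
    rw [map_mul, conj_ofReal, map_sub, map_one, mul_mul_mul_comm, h2]
    ring
  rw [e, cayley_add_conj]
  have := one_sub_ne_zero z
  have := one_sub_conj_ne_zero w
  have := one_sub_mul_conj_ne_zero z w
  field_simp

/-- The Schwarz–Pick inequality for holomorphic functions with nonnegative real part. -/
theorem norm_add_conj_sq_le {f : ℂ → ℂ} (hf : DifferentiableOn ℂ f (Metric.ball 0 1))
    (hre : ∀ z ∈ Metric.ball (0 : ℂ) 1, 0 ≤ (f z).re) (z w : 𝔻) :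
    ‖f z + conj (f w)‖ ^ 2 ≤ ‖cayley z + conj (cayley w)‖ ^ 2 *
      (((f z).re / (cayley z).re) * ((f w).re / (cayley w).re)) := by
  -- Cauchy–Schwarz for the Pick kernel, whose diagonal is Re f / Re p.
  have h := (isPosKernel_pick_cayley hf hre).normSq_le (fun z w ↦ by
    simp only [map_div₀, map_add, conj_conj, add_comm]) z w
  have hd : ∀ z : 𝔻, ((f z + conj (f z)) / (cayley z + conj (cayley z))).re =
      (f z).re / (cayley z).re := by
    intro z
    rw [add_conj, add_conj, ← ofReal_div, ofReal_re, mul_div_mul_left _ _ two_ne_zero]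
  rw [hd, hd, normSq_eq_norm_sq, norm_div, div_pow, div_le_iff₀] at h
  · linarith
  · have := norm_pos_iff.2 (cayley_add_conj_ne_zero z w)
    positivity

/-! ### Domination of the composed half-plane kernel -/

section SelfMap

variable {φ : ℂ → ℂ}

theorem coe_selfMap (hmaps : Set.MapsTo φ (Metric.ball 0 1) (Metric.ball 0 1)) (z : 𝔻) :
    (selfMap φ hmaps z : ℂ) = φ z := rfl

theorem differentiableOn_cayley_comp (hφ : DifferentiableOn ℂ φ (Metric.ball 0 1))
    (hmaps : Set.MapsTo φ (Metric.ball 0 1) (Metric.ball 0 1)) :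
    DifferentiableOn ℂ (fun z ↦ cayley (φ z)) (Metric.ball 0 1) := by
  unfold cayley
  refine DifferentiableOn.div (by fun_prop) (by fun_prop) fun z hz h ↦ ?_
  have := hmaps hz
  rw [← sub_eq_zero.1 h] at this
  simp at this

theorem differentiableOn_cayley : DifferentiableOn ℂ cayley (Metric.ball 0 1) :=
  differentiableOn_cayley_comp differentiableOn_id (Set.mapsTo_id _)

theorem hasSum_inv_cayley_add_conj (z w : 𝔻) :
    HasSum (fun n : ℕ ↦ (1 - (z : ℂ)) * z ^ n * conj ((1 - (w : ℂ)) * w ^ n) / 2)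
      (1 / (cayley z + conj (cayley w))) := by
  have hlt : ‖(z : ℂ) * conj (w : ℂ)‖ < 1 := by
    rw [norm_mul, Complex.norm_conj]
    exact mul_lt_one_of_nonneg_of_lt_one_left (norm_nonneg _) z.norm_lt_one w.norm_lt_one.le
  have h := (hasSum_geometric_of_norm_lt_one hlt).mul_left ((1 - (z : ℂ)) * (1 - conj (w : ℂ)) / 2)
  convert! h using 1
  · ext n
    simp only [map_mul, map_sub, map_one, map_pow]
    ring
  · rw [cayley_add_conj]
    have := one_sub_ne_zero z
    have := one_sub_conj_ne_zero w
    have := one_sub_mul_conj_ne_zero z w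
    field_simp

/-- The difference equals the Pick kernel of M q - p times 1/(q + conj q). The second factor is a
geometric sum of rank one kernels, so the product is a sum of modulated Pick kernels. -/
theorem isPosKernel_sub (hφ : DifferentiableOn ℂ φ (Metric.ball 0 1))
    (hmaps : Set.MapsTo φ (Metric.ball 0 1) (Metric.ball 0 1)) {M : ℝ}
    (hM : ∀ z : 𝔻, (cayley z).re ≤ M * (cayley (φ z)).re) :
    IsPosKernel fun z w : 𝔻 ↦ M / (cayley z + conj (cayley w)) -
      1 / (cayley (φ z) + conj (cayley (φ w))) := by
  have hpick := isPosKernel_pick_cayley (f := fun z ↦ M * cayley (φ z) - cayley z)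
    (((differentiableOn_cayley_comp hφ hmaps).const_mul _).sub differentiableOn_cayley) (by
      intro z hz
      have := hM (UnitDisc.mk z (by simpa using hz))
      simp only [UnitDisc.coe_mk] at this
      simpa using this)
  refine IsPosKernel.hasSum (Kn := fun (n : ℕ) (z w : 𝔻) ↦
    ((1 - φ z) * φ z ^ n * ((√2 / 2 : ℝ) : ℂ)) * conj ((1 - φ w) * φ w ^ n * ((√2 / 2 : ℝ) : ℂ)) *
    ((M * cayley (φ z) - cayley z + conj (M * cayley (φ w) - cayley w)) /
      (cayley z + conj (cayley w)))) (fun n ↦ hpick.modulate _) fun z w ↦ ?_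
  have hs := (hasSum_inv_cayley_add_conj (selfMap φ hmaps z) (selfMap φ hmaps w)).mul_right
    ((M * cayley (φ z) - cayley z + conj (M * cayley (φ w) - cayley w)) /
      (cayley z + conj (cayley w)))
  have h2 : ((√2 / 2 : ℝ) : ℂ) * ((√2 / 2 : ℝ) : ℂ) = 1 / 2 := by
    rw [← ofReal_mul, div_mul_div_comm, Real.mul_self_sqrt (by norm_num)]
    norm_num
  have hq := cayley_add_conj_ne_zero (selfMap φ hmaps z) (selfMap φ hmaps w)
  have hp := cayley_add_conj_ne_zero z w
  simp only [coe_selfMap] at hs hq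
  convert! hs using 1
  · ext n
    congr 1
    rw [map_mul _ _ ((√2 / 2 : ℝ) : ℂ), conj_ofReal, mul_mul_mul_comm, h2]
    ring
  · simp only [map_sub, map_mul, conj_ofReal]
    field_simp
    ring

end SelfMap

/-! ### Kernel functions of the space and composition operators -/

open scoped InnerProductSpace

/-- The space `H(b)` for `b(z) = (1 + z) / 2`. -/
abbrev HalfSpace := Space fun z ↦ (1 + z) / 2

/-- The kernel function of `H(b)` at the point `z`. -/
def kerAt (z : 𝔻) : HalfSpace := RKHS.kerFun HalfSpace z (1 : ℂ)

theorem inner_kerAt_left (z : 𝔻) (f : HalfSpace) : ⟪kerAt z, f⟫_ℂ = f z := by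
  simp [kerAt]

theorem kerAt_apply (z w : 𝔻) :
    kerAt w z = 1 / 2 + (1 - (z : ℂ)) * (1 - conj (w : ℂ)) / (4 * (1 - z * conj (w : ℂ))) := by
  rw [kerAt, RKHS.kerFun_apply, RKHS.OfKernel.kernel_ofKernel]
  have := one_sub_mul_conj_ne_zero z w
  simp only [kernel, Matrix.of_apply, map_div₀, map_add, map_one, map_ofNat, smul_apply,
    ContinuousLinearMap.id_apply, smul_eq_mul, mul_one]
  field_simp
  ring

theorem kerAt_apply_cayley (z w : 𝔻) :
    kerAt w z = 1 / 2 + 1 / 2 * (1 / (cayley z + conj (cayley w))) := by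
  rw [kerAt_apply, cayley_add_conj]
  have := one_sub_ne_zero z
  have := one_sub_conj_ne_zero w
  have := one_sub_mul_conj_ne_zero z w
  field_simp
  ring

theorem norm_kerAt_sq (z : 𝔻) : ‖kerAt z‖ ^ 2 = 1 / 2 + 1 / (4 * (cayley z).re) := by
  have h := inner_self_eq_norm_sq_to_K (𝕜 := ℂ) (kerAt z)
  rw [inner_kerAt_left, kerAt_apply_cayley, add_conj] at h
  have h2 : ((1 / 2 + 1 / 2 * (1 / (2 * (cayley z).re)) : ℝ) : ℂ) = ((‖kerAt z‖ ^ 2 : ℝ) : ℂ) := by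
    push_cast
    simpa using h
  rw [← ofReal_injective h2]
  have := cayley_re_pos z
  field_simp
  ring

/-- Puts norms into the form used by `IsPosKernel`; the point map g covers both k_z and k_{φ(z)}. -/
theorem re_inner_linearCombination (g : 𝔻 → 𝔻) (v : 𝔻 →₀ ℂ) :
    ‖Finsupp.linearCombination ℂ (fun z ↦ kerAt (g z)) v‖ ^ 2 =
      (∑ z ∈ v.support, ∑ w ∈ v.support, conj (v z) * conj (conj (v w)) * kerAt (g w) (g z)).re := by
  rw [← inner_self_eq_norm_sq (𝕜 := ℂ), Finsupp.linearCombination_apply, Finsupp.sum]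
  simp only [sum_inner, inner_sum, inner_smul_left, inner_smul_right, inner_kerAt_left,
    conj_conj, mul_assoc, Finset.mul_sum]
  rw [Finset.sum_comm]
  refine congrArg re (Finset.sum_congr rfl fun x _ ↦ Finset.sum_congr rfl fun y _ ↦ ?_)
  ring

theorem denseRange_linearCombination_kerAt :
    DenseRange (Finsupp.linearCombination ℂ kerAt) := by
  have h := RKHS.kerFun_dense HalfSpace
  have hsub : Submodule.span ℂ {RKHS.kerFun HalfSpace x v | (x) (v)} ≤
      LinearMap.range (Finsupp.linearCombination ℂ kerAt) := by
    rw [Submodule.span_le]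
    rintro _ ⟨x, v, rfl⟩
    refine ⟨Finsupp.single x v, ?_⟩
    rw [Finsupp.linearCombination_single, kerAt, ← map_smul, smul_eq_mul, mul_one]
  intro x
  have hx : x ∈ (Submodule.span ℂ {RKHS.kerFun HalfSpace x v | (x) (v)}).topologicalClosure := by
    rw [h]; trivial
  exact closure_mono hsub hx

/-- Boundedness of a composition operator follows from positivity of a difference of kernels. -/
theorem compositionBounded_of_isPosKernel {φ : 𝔻 → 𝔻} {M : ℝ} (hM : 0 ≤ M)
    (h : IsPosKernel fun z w : 𝔻 ↦ (M : ℂ) * kerAt w z - kerAt (φ w) (φ z)) :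
    CompositionBounded (fun z ↦ (1 + z) / 2) φ := by
  have hnorm : ∀ v, ‖Finsupp.linearCombination ℂ (fun z ↦ kerAt (φ z)) v‖ ≤
      √M * ‖Finsupp.linearCombination ℂ kerAt v‖ := by
    intro v
    rw [← abs_of_nonneg (norm_nonneg (Finsupp.linearCombination ℂ (fun z ↦ kerAt (φ z)) v))]
    refine abs_le_of_sq_le_sq ?_ (by positivity)
    rw [mul_pow, Real.sq_sqrt hM, re_inner_linearCombination φ v,
      re_inner_linearCombination (fun z ↦ z) v]
    have := h v.support fun z ↦ conj (v z)
    simp only [mul_sub, Finset.sum_sub_distrib, sub_re] at this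
    rw [← re_ofReal_mul, Finset.mul_sum]
    simp only [Finset.mul_sum]
    refine (sub_nonneg.1 this).trans_eq (congrArg re ?_)
    refine Finset.sum_congr rfl fun z _ ↦ Finset.sum_congr rfl fun w _ ↦ ?_
    ring
  -- A is the prospective adjoint k_z ↦ k_{φ(z)}, extended from the dense span of kernels; its
  -- adjoint is composition with φ.
  set A := (Finsupp.linearCombination ℂ (fun z ↦ kerAt (φ z))).extendOfNorm
    (Finsupp.linearCombination ℂ kerAt) with hA
  have hAk : ∀ z, A (kerAt z) = kerAt (φ z) := by
    intro z
    have := LinearMap.extendOfNorm_eq denseRange_linearCombination_kerAt ⟨_, hnorm⟩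
      (Finsupp.single z (1 : ℂ))
    simpa using this
  refine ⟨ContinuousLinearMap.adjoint A, fun f z ↦ ?_⟩
  rw [← inner_kerAt_left, ContinuousLinearMap.adjoint_inner_right, hAk, inner_kerAt_left]

/-! ### Radial approach and the boundary kernel at 1 -/

/-- The points `n / (n + 2)`, whose Cayley transforms are the positive integers. -/
def radial (n : ℕ) : 𝔻 := UnitDisc.mk ((n / (n + 2) : ℝ) : ℂ) (by
  rw [norm_real, Real.norm_of_nonneg (by positivity), div_lt_one (by positivity)]
  linarith)

theorem coe_radial (n : ℕ) : (radial n : ℂ) = ((n / (n + 2) : ℝ) : ℂ) := rfl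

theorem cayley_radial (n : ℕ) : cayley (radial n) = ((n + 1 : ℝ) : ℂ) := by
  rw [cayley, coe_radial, ← ofReal_one, ← ofReal_add, ← ofReal_sub, ← ofReal_div]
  congr 1
  have : (n : ℝ) + 2 ≠ 0 := by positivity
  field_simp
  ring

theorem tendsto_radial : Tendsto (fun n ↦ (radial n : ℂ)) atTop (𝓝 1) := by
  simp only [coe_radial]
  rw [← ofReal_one]
  refine (continuous_ofReal.tendsto 1).comp ?_
  simpa using tendsto_natCast_div_add_atTop (2 : ℝ)

/-- On the radius [0, 1), |z - 1| = 1 - |z|, so any aperture above 1 would serve. -/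
theorem tendsto_radial_stolz :
    Tendsto radial atTop (comap (fun z : 𝔻 ↦ (z : ℂ)) (𝓝 1) ⊓ 𝓟 (stolzRegion 1 2)) := by
  refine tendsto_inf.2 ⟨tendsto_comap_iff.2 tendsto_radial, tendsto_principal.2 ?_⟩
  refine Eventually.of_forall fun n ↦ ?_
  rw [stolzRegion, Set.mem_ofPred_eq, coe_radial, ← ofReal_one, ← ofReal_sub, norm_real, norm_real,
    Real.norm_of_nonneg (by positivity : (0 : ℝ) ≤ n / (n + 2)), Real.norm_eq_abs, abs_sub_comm]
  have : (n : ℝ) / (n + 2) < 1 := by rw [div_lt_one (by positivity)]; linarith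
  rw [abs_of_pos (by linarith)]
  linarith

theorem HasNontangentialLimit.tendsto_radial {f : 𝔻 → ℂ} {L : ℂ}
    (h : HasNontangentialLimit f 1 L) : Tendsto (fun n ↦ f (radial n)) atTop (𝓝 L) :=
  (h 2).comp tendsto_radial_stolz

/-- The approach to 1 is unrestricted because it is also applied along φ(radial n). -/
theorem tendsto_kerAt_apply {w : ℕ → 𝔻} (hw : Tendsto (fun n ↦ (w n : ℂ)) atTop (𝓝 1)) (z : 𝔻) :
    Tendsto (fun n ↦ kerAt (w n) z) atTop (𝓝 (1 / 2)) := by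
  simp only [kerAt_apply]
  have hc : Tendsto (fun n ↦ conj (w n : ℂ)) atTop (𝓝 1) := by
    have := (continuous_conj.tendsto 1).comp hw
    rwa [map_one] at this
  have h1 := (((tendsto_const_nhds (x := (1 : ℂ))).sub hc).const_mul (1 - (z : ℂ))).div
    (((tendsto_const_nhds (x := (1 : ℂ))).sub (hc.const_mul (z : ℂ))).const_mul 4)
    (by simpa using one_sub_ne_zero z)
  have h2 := h1.const_add (1 / 2)
  rwa [sub_self, mul_zero, zero_div, add_zero] at h2

theorem norm_sub_sq_kerAt_radial (n m : ℕ) : ‖kerAt (radial n) - kerAt (radial m)‖ ^ 2 =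
    1 / (4 * (n + 1 : ℝ)) + 1 / (4 * (m + 1 : ℝ)) - 1 / (n + 1 + (m + 1) : ℝ) := by
  rw [norm_sub_sq (𝕜 := ℂ), inner_kerAt_left, norm_kerAt_sq, norm_kerAt_sq, kerAt_apply_cayley,
    cayley_radial, cayley_radial, conj_ofReal, ofReal_re, ofReal_re, ← ofReal_add]
  have : (1 / 2 + 1 / 2 * (1 / ((n + 1 + (m + 1) : ℝ) : ℂ))) =
      ((1 / 2 + 1 / 2 * (1 / (n + 1 + (m + 1) : ℝ)) : ℝ) : ℂ) := by push_cast; ring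
  rw [this]
  simp only [RCLike.re_to_complex, ofReal_re]
  ring

theorem cauchySeq_kerAt_radial : CauchySeq fun n ↦ kerAt (radial n) := by
  refine cauchySeq_of_le_tendsto_0 (fun N : ℕ ↦ √(1 / ((N : ℝ) + 1))) (fun n m N hn hm ↦ ?_) ?_
  · rw [dist_eq_norm]
    refine Real.le_sqrt_of_sq_le ?_
    rw [norm_sub_sq_kerAt_radial]
    have hn' : (N : ℝ) ≤ n := by exact_mod_cast hn
    have hm' : (N : ℝ) ≤ m := by exact_mod_cast hm
    have h1 : 1 / (4 * (n + 1 : ℝ)) ≤ 1 / (2 * (N + 1 : ℝ)) :=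
      one_div_le_one_div_of_le (by positivity) (by linarith)
    have h2 : 1 / (4 * (m + 1 : ℝ)) ≤ 1 / (2 * (N + 1 : ℝ)) :=
      one_div_le_one_div_of_le (by positivity) (by linarith)
    have h3 : 0 ≤ 1 / (n + 1 + (m + 1) : ℝ) := by positivity
    have h4 : 1 / (2 * (N + 1 : ℝ)) + 1 / (2 * (N + 1 : ℝ)) = 1 / ((N : ℝ) + 1) := by
      field_simp; norm_num
    linarith
  · have := (Real.continuous_sqrt.tendsto 0).comp (tendsto_one_div_add_atTop_nhds_zero_nat (𝕜 := ℝ))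
    rwa [Real.sqrt_zero] at this

/-- The boundary kernel of `H(b)` at `1` is the constant function `1 / 2`. -/
theorem exists_boundaryKernel : ∃ e : HalfSpace,
    Tendsto (fun n ↦ kerAt (radial n)) atTop (𝓝 e) ∧ ∀ z, e z = 1 / 2 := by
  obtain ⟨e, he⟩ := cauchySeq_tendsto_of_complete cauchySeq_kerAt_radial
  refine ⟨e, he, fun z ↦ ?_⟩
  exact tendsto_nhds_unique (((RKHS.continuous_eval z).tendsto e).comp he)
    (tendsto_kerAt_apply tendsto_radial z)

/-- Pythagoras for (a - c)e + a(k_z - e): since ⟨k_z, e⟩ = 1/2 = ‖e‖², k_z - e is orthogonal to e.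
-/
theorem norm_smul_kerAt_sub_smul_sq {e : HalfSpace}
    (he : ∀ z, e z = 1 / 2) (hee : ‖e‖ ^ 2 = 1 / 2) (z : 𝔻) (a c : ℂ) :
    ‖a • kerAt z - c • e‖ ^ 2 = ‖a - c‖ ^ 2 / 2 + ‖a‖ ^ 2 / (4 * (cayley z).re) := by
  rw [norm_sub_sq (𝕜 := ℂ), inner_smul_left, inner_smul_right, inner_kerAt_left, he, norm_smul,
    norm_smul, mul_pow, mul_pow, norm_kerAt_sq, hee]
  simp only [RCLike.re_to_complex, ← normSq_eq_norm_sq, normSq_apply, mul_re, conj_re, conj_im,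
    mul_im, sub_re, sub_im]
  norm_num
  ring

theorem norm_boundaryKernel_sq {e : HalfSpace}
    (hlim : Tendsto (fun n ↦ kerAt (radial n)) atTop (𝓝 e)) (he : ∀ z, e z = 1 / 2) :
    ‖e‖ ^ 2 = 1 / 2 := by
  have h1 : Tendsto (fun n ↦ ⟪kerAt (radial n), e⟫_ℂ) atTop (𝓝 ⟪e, e⟫_ℂ) :=
    hlim.inner tendsto_const_nhds
  simp only [inner_kerAt_left, he] at h1
  have h2 := tendsto_nhds_unique h1 tendsto_const_nhds
  rw [← inner_self_eq_norm_sq (𝕜 := ℂ), h2]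
  norm_num

/-! ### Boundedness forces linear growth -/

/-- A bounded weighted composition operator whose weight has a nonzero radial limit at `1` forces
`φ` to approach `1` at most linearly. -/
theorem exists_le_norm_cayley_of_weighted {φ : 𝔻 → 𝔻} {u : 𝔻 → ℂ} {c : ℂ} (hc : c ≠ 0)
    (hu : Tendsto (fun n ↦ u (radial n)) atTop (𝓝 c))
    (hφ : Tendsto (fun n ↦ (φ (radial n) : ℂ)) atTop (𝓝 1))
    (hW : WeightedCompositionBounded (fun z ↦ (1 + z) / 2) u φ) :
    ∃ κ > 0, ∀ᶠ n : ℕ in atTop, κ * (n + 1 : ℝ) ≤ ‖cayley (φ (radial n))‖ := by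
  obtain ⟨W, hW⟩ := hW
  obtain ⟨e, hlim, he⟩ := exists_boundaryKernel
  have hee := norm_boundaryKernel_sq hlim he
  set A := ContinuousLinearMap.adjoint W with hA
  have hAk : ∀ z, A (kerAt z) = conj (u z) • kerAt (φ z) := by
    intro z
    refine ext_inner_right ℂ fun f ↦ ?_
    rw [hA, ContinuousLinearMap.adjoint_inner_left, inner_kerAt_left, hW, inner_smul_left,
      inner_kerAt_left, conj_conj]
  have hAe : A e = conj c • e := by
    refine RKHS.ext fun z ↦ ?_
    have h1 : Tendsto (fun n ↦ A (kerAt (radial n)) z) atTop (𝓝 (A e z)) :=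
      ((RKHS.continuous_eval z).tendsto _).comp ((A.continuous.tendsto e).comp hlim)
    have h2 : Tendsto (fun n ↦ A (kerAt (radial n)) z) atTop (𝓝 (conj c * (1 / 2))) := by
      simp only [hAk, RKHS.coe_smul, Pi.smul_apply, smul_eq_mul]
      exact ((continuous_conj.tendsto c).comp hu).mul (tendsto_kerAt_apply hφ z)
    rw [tendsto_nhds_unique h1 h2, RKHS.coe_smul, Pi.smul_apply, smul_eq_mul, he]
  -- Apply A to k_n - e, of squared norm 1/(4(n+1)); the image conj u k_{φ} - conj c e has squared
  -- norm at least |u|²/(4 Re q).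
  have hbound : ∀ n, ‖u (radial n)‖ ^ 2 * (n + 1 : ℝ) ≤
      ‖A‖ ^ 2 * ‖cayley (φ (radial n))‖ := by
    intro n
    have h1 := A.le_opNorm ((1 : ℂ) • kerAt (radial n) - (1 : ℂ) • e)
    have h2 := pow_le_pow_left₀ (norm_nonneg _) h1 2
    rw [mul_pow, norm_smul_kerAt_sub_smul_sq he hee, one_smul, one_smul, map_sub, hAk, hAe,
      norm_smul_kerAt_sub_smul_sq he hee, cayley_radial, norm_conj, ofReal_re, sub_self] at h2
    have hq := cayley_re_pos (φ (radial n))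
    have h3 : ‖u (radial n)‖ ^ 2 / (4 * (cayley (φ (radial n))).re) ≤
        ‖A‖ ^ 2 * (1 / (4 * (n + 1 : ℝ))) := by
      refine le_trans (le_add_of_nonneg_left (by positivity)) (h2.trans_eq ?_)
      simp
    have h4 : ‖u (radial n)‖ ^ 2 * (n + 1 : ℝ) ≤ ‖A‖ ^ 2 * (cayley (φ (radial n))).re := by
      rw [mul_one_div, div_le_div_iff₀ (by positivity) (by positivity)] at h3
      linarith
    exact h4.trans (mul_le_mul_of_nonneg_left (re_le_norm _) (by positivity))
  have hcpos : 0 < ‖c‖ := norm_pos_iff.2 hc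
  have hev : ∀ᶠ n in atTop, ‖c‖ / 2 < ‖u (radial n)‖ :=
    hu.norm.eventually (lt_mem_nhds (by linarith))
  refine ⟨(‖c‖ / 2) ^ 2 / (‖A‖ ^ 2 + 1), by positivity, hev.mono fun n hn ↦ ?_⟩
  have h1 := hbound n
  have h2 : (‖c‖ / 2) ^ 2 ≤ ‖u (radial n)‖ ^ 2 := by gcongr
  have h3 : (‖c‖ / 2) ^ 2 * (n + 1 : ℝ) ≤ ‖u (radial n)‖ ^ 2 * (n + 1 : ℝ) := by gcongr
  rw [div_mul_eq_mul_div, div_le_iff₀ (by positivity)]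
  nlinarith [norm_nonneg (cayley (φ (radial n)))]

theorem IsPosKernel.smul {X : Type*} {K : X → X → ℂ} (hK : IsPosKernel K) {r : ℝ} (hr : 0 ≤ r) :
    IsPosKernel fun x y ↦ (r : ℂ) * K x y := by
  intro s c
  have : ∑ x ∈ s, ∑ y ∈ s, c x * conj (c y) * ((r : ℂ) * K x y) =
      (r : ℂ) * ∑ x ∈ s, ∑ y ∈ s, c x * conj (c y) * K x y := by
    simp only [Finset.mul_sum]
    exact Finset.sum_congr rfl fun x _ ↦ Finset.sum_congr rfl fun y _ ↦ by ring
  rw [this, re_ofReal_mul]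
  exact mul_nonneg hr (hK s c)

/-! ### Julia's inequality and sufficiency -/

section

variable {φ : ℂ → ℂ}

/-- Julia's inequality in the half-plane. -/
theorem julia (hφ : DifferentiableOn ℂ φ (Metric.ball 0 1))
    (hmaps : Set.MapsTo φ (Metric.ball 0 1) (Metric.ball 0 1))
    {κ : ℝ} (h : ∀ᶠ n : ℕ in atTop, κ * (n + 1 : ℝ) ≤ ‖cayley (φ (radial n))‖)
    (z : 𝔻) : κ * (cayley z).re ≤ (cayley (φ z)).re := by
  have hpos : ∀ z : 𝔻, 0 < (cayley (φ z)).re := fun z ↦ cayley_re_pos (selfMap φ hmaps z)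
  have hp := cayley_re_pos z
  rw [← le_div_iff₀ hp]
  set R := (cayley (φ z)).re / (cayley z).re with hR
  have hR0 : 0 < R := div_pos (hpos z) hp
  set a := ‖cayley (φ z)‖
  set b := ‖cayley z‖
  have hinv : Tendsto (fun n : ℕ ↦ 1 / ((n : ℝ) + 1)) atTop (𝓝 0) :=
    tendsto_one_div_add_atTop_nhds_zero_nat
  have hL : Tendsto (fun n : ℕ ↦ κ - 2 * a * (1 / ((n : ℝ) + 1))) atTop (𝓝 κ) := by
    simpa using (hinv.const_mul (2 * a)).const_sub κ
  have hRt : Tendsto (fun n : ℕ ↦ (b * (1 / ((n : ℝ) + 1)) + 1) ^ 2 * R) atTop (𝓝 R) := by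
    simpa using (((hinv.const_mul b).add_const 1).pow 2).mul_const R
  -- Schwarz–Pick between z and the nth radial point gives (Q - a)² ≤ (b + N)² R Q/N. Drop a²,
  -- divide by QN, use κN ≤ Q, and let N → ∞.
  refine le_of_tendsto_of_tendsto hL hRt (h.mono fun n hn ↦ ?_)
  have hN : (0 : ℝ) < n + 1 := by positivity
  set N : ℝ := n + 1
  have hQ : 0 < ‖cayley (φ (radial n))‖ :=
    (hpos (radial n)).trans_le (re_le_norm _)
  have h1 := norm_add_conj_sq_le (differentiableOn_cayley_comp hφ hmaps)
    (fun z hz ↦ (hpos (UnitDisc.mk z (by simpa using hz))).le) z (radial n)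
  rw [cayley_radial, conj_ofReal, ofReal_re, ← hR] at h1
  have h2 : ‖cayley z + (N : ℂ)‖ ^ 2 ≤ (b + N) ^ 2 := by
    refine pow_le_pow_left₀ (norm_nonneg _) ((norm_add_le _ _).trans_eq ?_) 2
    rw [norm_real, Real.norm_of_nonneg hN.le]
  have h3 : (‖cayley (φ (radial n))‖ - a) ^ 2 ≤
      ‖cayley (φ z) + conj (cayley (φ (radial n)))‖ ^ 2 := by
    rw [sq_le_sq, abs_norm]
    have := abs_norm_sub_norm_le (conj (cayley (φ (radial n)))) (-cayley (φ z))
    rwa [norm_conj, norm_neg, sub_neg_eq_add, add_comm (conj _)] at this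
  set Q := ‖cayley (φ (radial n))‖ with hQdef
  have h4 : (cayley (φ (radial n))).re / N ≤ Q / N := by
    gcongr
    exact re_le_norm _
  have h5 : (Q - a) ^ 2 ≤ (b + N) ^ 2 * (R * (Q / N)) :=
    h3.trans (h1.trans (mul_le_mul h2 (mul_le_mul_of_nonneg_left h4 hR0.le)
      (mul_nonneg hR0.le (div_nonneg (hpos (radial n)).le hN.le)) (sq_nonneg _)))
  have h6 : Q * (Q - 2 * a) ≤ Q * ((b + N) ^ 2 * R / N) := by
    have : (b + N) ^ 2 * (R * (Q / N)) = Q * ((b + N) ^ 2 * R / N) := by ring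
    nlinarith [sq_nonneg a]
  have h7 := le_of_mul_le_mul_left h6 hQ
  have h8 : (κ * N - 2 * a) / N ≤ ((b + N) ^ 2 * R / N) / N := by
    gcongr
    linarith
  calc κ - 2 * a * (1 / N) = (κ * N - 2 * a) / N := by field_simp
    _ ≤ ((b + N) ^ 2 * R / N) / N := h8
    _ = (b * (1 / N) + 1) ^ 2 * R := by field_simp

theorem compositionBounded_of_julia (hφ : DifferentiableOn ℂ φ (Metric.ball 0 1))
    (hmaps : Set.MapsTo φ (Metric.ball 0 1) (Metric.ball 0 1))
    {κ : ℝ} (hκ : 0 < κ)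
    (h : ∀ z : 𝔻, κ * (cayley z).re ≤ (cayley (φ z)).re) :
    CompositionBounded (fun z ↦ (1 + z) / 2) (selfMap φ hmaps) := by
  -- M ≥ 1 keeps the constant part (M - 1)/2 of the kernel difference nonnegative; M ≥ 1/κ handles
  -- the half-plane part.
  have hM1 : (1 : ℝ) ≤ max 1 (1 / κ) := le_max_left _ _
  have hMκ : 1 / κ ≤ max 1 (1 / κ) := le_max_right _ _
  set M : ℝ := max 1 (1 / κ)
  refine compositionBounded_of_isPosKernel (M := M) (by linarith) ?_
  have hpos := isPosKernel_sub hφ hmaps (M := M) fun z ↦ by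
    have hq : 0 < (cayley (φ z)).re := cayley_re_pos (selfMap φ hmaps z)
    calc (cayley z).re ≤ 1 / κ * (cayley (φ z)).re := by
          rw [one_div_mul_eq_div, le_div_iff₀ hκ, mul_comm]; exact h z
      _ ≤ M * (cayley (φ z)).re := by gcongr
  have hsum := (IsPosKernel.const_nonneg (X := 𝔻) (r := (M - 1) / 2) (by linarith)).add
    (hpos.smul (r := 1 / 2) (by norm_num))
  convert! hsum using 3 with z w
  rw [kerAt_apply_cayley, kerAt_apply_cayley, coe_selfMap, coe_selfMap]
  push_cast
  ring

/-! ### The Julia–Carathéodory theorem -/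

/-- The Cayley transform carries Stolz regions into sectors; the 2 comes from |1 + z| ≤ 2. -/
theorem norm_cayley_le_of_mem_stolz {α : ℝ} {z : 𝔻} (hz : z ∈ stolzRegion 1 α) :
    ‖cayley z‖ ≤ 2 * α * (cayley z).re := by
  have hz' : ‖1 - (z : ℂ)‖ < α * (1 - ‖(z : ℂ)‖) := by rw [norm_sub_rev]; exact hz
  have h1 : 0 < ‖1 - (z : ℂ)‖ := norm_pos_iff.2 (one_sub_ne_zero z)
  have hlt := z.norm_lt_one
  have hα : 0 < α := pos_of_mul_pos_left (h1.trans hz') (by linarith)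
  rw [cayley_re, cayley, norm_div, mul_div_assoc', div_le_div_iff₀ h1 (by positivity)]
  have h2 : ‖1 + (z : ℂ)‖ ≤ 2 := by
    refine (norm_add_le _ _).trans ?_
    rw [norm_one]; linarith
  have h3 : α * (1 - ‖(z : ℂ)‖) ≤ α * (1 - ‖(z : ℂ)‖ ^ 2) := by
    gcongr; nlinarith [norm_nonneg (z : ℂ)]
  calc ‖1 + (z : ℂ)‖ * ‖1 - (z : ℂ)‖ ^ 2 ≤ 2 * ‖1 - (z : ℂ)‖ ^ 2 := by gcongr
    _ = 2 * ‖1 - (z : ℂ)‖ * ‖1 - (z : ℂ)‖ := by ring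
    _ ≤ 2 * (α * (1 - ‖(z : ℂ)‖ ^ 2)) * ‖1 - (z : ℂ)‖ := by gcongr; linarith
    _ = 2 * α * (1 - ‖(z : ℂ)‖ ^ 2) * ‖1 - (z : ℂ)‖ := by ring

theorem eventually_le_norm_cayley (B : ℝ) :
    ∀ᶠ z : 𝔻 in comap (fun z : 𝔻 ↦ (z : ℂ)) (𝓝 1), B ≤ ‖cayley z‖ := by
  have hc : Tendsto (fun z : ℂ ↦ (1 - z) / (1 + z)) (𝓝 1) (𝓝 0) := by
    have : ContinuousAt (fun z : ℂ ↦ (1 - z) / (1 + z)) 1 :=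
      ContinuousAt.div (by fun_prop) (by fun_prop) (by norm_num)
    simpa [ContinuousAt] using this
  have hB : 0 < (|B| + 1)⁻¹ := by positivity
  have h := (hc.comp (tendsto_comap (f := fun z : 𝔻 ↦ (z : ℂ)))).norm.eventually
    (gt_mem_nhds (by simpa using hB : ‖(0 : ℂ)‖ < (|B| + 1)⁻¹))
  refine h.mono fun z hz ↦ ?_
  have e : (1 - (z : ℂ)) / (1 + z) = (cayley z)⁻¹ := by rw [cayley, inv_div]
  rw [Function.comp_apply, e, norm_inv, inv_lt_inv₀ (norm_pos_iff.2 (cayley_ne_zero z))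
    (by positivity)] at hz
  linarith [le_abs_self B]

/-- A function with nonnegative real part whose real part is somewhere small compared with that of
the Cayley transform is nontangentially small compared with it. -/
theorem eventually_norm_le_mul_norm_cayley {f : ℂ → ℂ}
    (hf : DifferentiableOn ℂ f (Metric.ball 0 1))
    (hre : ∀ z ∈ Metric.ball (0 : ℂ) 1, 0 ≤ (f z).re)
    (hinf : ∀ ε > 0, ∃ z : 𝔻, (f z).re ≤ ε * (cayley z).re) (α : ℝ) {ε : ℝ} (hε : 0 < ε) :
    ∀ᶠ z : 𝔻 in comap (fun z : 𝔻 ↦ (z : ℂ)) (𝓝 1) ⊓ 𝓟 (stolzRegion 1 α),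
      ‖f z‖ ≤ ε * ‖cayley z‖ := by
  -- Near 1 the terms at z₀ are absorbed, and Schwarz–Pick reads S²/4 ≤ 4P² · (2(|α| + 1)S/P) · ε',
  -- that is S ≤ 32(|α| + 1)ε'P.
  obtain ⟨ε', hε', hεdef⟩ : ∃ ε' > 0, ε' * (32 * (|α| + 1)) = ε :=
    ⟨ε / (32 * (|α| + 1)), by positivity, by field_simp⟩
  obtain ⟨z₀, hz₀⟩ := hinf ε' hε'
  have hp₀ := cayley_re_pos z₀
  filter_upwards [mem_inf_of_left (eventually_le_norm_cayley ‖cayley z₀‖),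
    mem_inf_of_left (eventually_le_norm_cayley (‖f z₀‖ / ε')),
    mem_inf_of_right (mem_principal_self _)] with z h1 h2 h3
  have hst := norm_cayley_le_of_mem_stolz h3
  have hp := cayley_re_pos z
  have hP : 0 < ‖cayley z‖ := norm_pos_iff.2 (cayley_ne_zero z)
  have hkey := norm_add_conj_sq_le hf hre z z₀
  rw [div_le_iff₀ hε'] at h2
  by_contra! hS
  have hα : 0 ≤ |α| := abs_nonneg α
  have hαle := le_abs_self α
  set P := ‖cayley z‖
  set S := ‖f z‖
  have hS0 : 0 < S := lt_trans (by positivity) hS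
  have hε2 : 2 * ε' ≤ ε := by nlinarith
  have h4 : ‖f z₀‖ ≤ S / 2 := by nlinarith
  have h5 : (S / 2) ^ 2 ≤ ‖f z + conj (f z₀)‖ ^ 2 := by
    refine pow_le_pow_left₀ (by positivity) ?_ 2
    have := norm_sub_norm_le (f z) (-conj (f z₀))
    rw [norm_neg, norm_conj, sub_neg_eq_add] at this
    linarith
  have h6 : ‖cayley z + conj (cayley z₀)‖ ^ 2 ≤ (2 * P) ^ 2 := by
    refine pow_le_pow_left₀ (norm_nonneg _) ((norm_add_le _ _).trans ?_) 2
    rw [norm_conj]; linarith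
  have h7 : (f z).re / (cayley z).re ≤ S * (2 * (|α| + 1)) / P := by
    rw [div_le_div_iff₀ hp hP]
    calc (f z).re * P ≤ S * P := by gcongr; exact re_le_norm _
      _ ≤ S * (2 * (|α| + 1) * (cayley z).re) := by
          gcongr
          exact hst.trans (by gcongr; linarith)
      _ = S * (2 * (|α| + 1)) * (cayley z).re := by ring
  have h8 : (f z₀).re / (cayley z₀).re ≤ ε' := by rwa [div_le_iff₀ hp₀]
  have h9 : (S / 2) ^ 2 ≤ (2 * P) ^ 2 * (S * (2 * (|α| + 1)) / P * ε') := by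
    refine h5.trans (hkey.trans ?_)
    have hz := hre z (by simpa using z.norm_lt_one)
    have hz₀ := hre z₀ (by simpa using z₀.norm_lt_one)
    exact mul_le_mul h6 (mul_le_mul h7 h8 (div_nonneg hz₀ hp₀.le) (by positivity))
      (mul_nonneg (div_nonneg hz hp.le) (div_nonneg hz₀ hp₀.le)) (sq_nonneg _)
  have h10 : (2 * P) ^ 2 * (S * (2 * (|α| + 1)) / P * ε') =
      S * (ε' * (32 * (|α| + 1)) * P) / 4 := by
    field_simp
    norm_num
  rw [h10, hεdef] at h9
  nlinarith

/-- The Julia–Carathéodory theorem for the difference quotient. -/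
theorem exists_tendsto_quotient (hφ : DifferentiableOn ℂ φ (Metric.ball 0 1))
    (hmaps : Set.MapsTo φ (Metric.ball 0 1) (Metric.ball 0 1))
    (hφ1 : HasNontangentialLimit (fun z : 𝔻 ↦ φ z) 1 1) {κ : ℝ}
    (hκ : 0 < κ) (h : ∀ z : 𝔻, κ * (cayley z).re ≤ (cayley (φ z)).re) :
    ∃ δ : ℂ, HasNontangentialLimit (fun z : 𝔻 ↦ (1 - φ z) / (1 - z)) 1 δ := by
  have hq : ∀ z : 𝔻, 0 < (cayley (φ z)).re := fun z ↦ cayley_re_pos (selfMap φ hmaps z)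
  have hbdd : BddBelow (Set.range fun z : 𝔻 ↦ (cayley (φ z)).re / (cayley z).re) :=
    ⟨κ, by rintro _ ⟨z, rfl⟩; exact (le_div_iff₀ (cayley_re_pos z)).2 (h z)⟩
  -- With l the infimum of Re q / Re p, q - l p keeps nonnegative real part and its ratio to Re p
  -- has infimum 0. Hence q/p → l nontangentially.
  obtain ⟨l, hl⟩ : ∃ l, l = ⨅ z : 𝔻, (cayley (φ z)).re / (cayley z).re := ⟨_, rfl⟩
  have hlκ : κ ≤ l := by
    rw [hl]
    exact le_ciInf fun z ↦ (le_div_iff₀ (cayley_re_pos z)).2 (h z)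
  have hlpos : 0 < l := hκ.trans_le hlκ
  have hle : ∀ z : 𝔻, l * (cayley z).re ≤ (cayley (φ z)).re := fun z ↦ by
    rw [← le_div_iff₀ (cayley_re_pos z), hl]
    exact ciInf_le hbdd z
  have hsmall : ∀ ε > 0, ∃ z : 𝔻, (cayley (φ z) - l * cayley z).re ≤ ε * (cayley z).re := by
    intro ε hε
    obtain ⟨z, hz⟩ := exists_lt_of_ciInf_lt (show ⨅ z : 𝔻, (cayley (φ z)).re / (cayley z).re <
      l + ε by rw [← hl]; linarith)
    refine ⟨z, ?_⟩
    rw [div_lt_iff₀ (cayley_re_pos z)] at hz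
    rw [sub_re, re_ofReal_mul]
    linarith
  refine ⟨(l : ℂ)⁻¹, fun α ↦ ?_⟩
  have hlim : Tendsto (fun z : 𝔻 ↦ cayley (φ z) / cayley z)
      (comap (fun z : 𝔻 ↦ (z : ℂ)) (𝓝 1) ⊓ 𝓟 (stolzRegion 1 α)) (𝓝 l) := by
    rw [Metric.tendsto_nhds]
    intro ε hε
    have := eventually_norm_le_mul_norm_cayley (f := fun z ↦ cayley (φ z) - l * cayley z)
      ((differentiableOn_cayley_comp hφ hmaps).sub (differentiableOn_cayley.const_mul _))
      (fun z hz ↦ by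
        have := hle (UnitDisc.mk z (by simpa using hz))
        rw [UnitDisc.coe_mk] at this
        rw [sub_re, re_ofReal_mul]
        linarith) hsmall α (half_pos hε)
    refine this.mono fun z hz ↦ ?_
    have hP : 0 < ‖cayley z‖ := norm_pos_iff.2 (cayley_ne_zero z)
    have e : cayley (φ z) / cayley z - l = (cayley (φ z) - l * cayley z) / cayley z := by
      rw [sub_div, mul_div_cancel_right₀ _ (cayley_ne_zero z)]
    rw [dist_eq_norm, e, norm_div, div_lt_iff₀ hP]
    nlinarith
  have hz1 : Tendsto (fun z : 𝔻 ↦ (z : ℂ))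
      (comap (fun z : 𝔻 ↦ (z : ℂ)) (𝓝 1) ⊓ 𝓟 (stolzRegion 1 α)) (𝓝 1) :=
    tendsto_comap.mono_left inf_le_left
  -- (1 - φ)/(1 - z) = ((1 + φ)/(1 + z)) · (p/q), and the first factor tends to 1.
  have hr : Tendsto (fun z : 𝔻 ↦ (1 + φ z) / (1 + (z : ℂ)))
      (comap (fun z : 𝔻 ↦ (z : ℂ)) (𝓝 1) ⊓ 𝓟 (stolzRegion 1 α)) (𝓝 1) := by
    have := ((hφ1 α).const_add 1).div (hz1.const_add 1) (by norm_num)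
    rwa [div_self (by norm_num : (1 : ℂ) + 1 ≠ 0)] at this
  have hprod := hr.mul (hlim.inv₀ (ofReal_ne_zero.2 hlpos.ne'))
  rw [one_mul] at hprod
  refine hprod.congr fun z ↦ ?_
  have e1 := one_sub_ne_zero z
  have e2 := z.one_add_coe_ne_zero
  have e3 : 1 - φ z ≠ 0 := one_sub_ne_zero (selfMap φ hmaps z)
  have e4 : 1 + φ z ≠ 0 := (selfMap φ hmaps z).one_add_coe_ne_zero
  simp only [cayley]
  field_simp

/-- If the difference quotient at `1` has a nontangential limit, then so has the derivative. -/
theorem hasNontangentialLimit_deriv (hφ : DifferentiableOn ℂ φ (Metric.ball 0 1))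
    {δ : ℂ}
    (h : HasNontangentialLimit (fun z : 𝔻 ↦ (1 - φ z) / (1 - z)) 1 δ) :
    HasNontangentialLimit (fun z : 𝔻 ↦ deriv φ z) 1 δ := by
  intro α
  rw [Metric.tendsto_nhds]
  intro ε hε
  -- For z in the region of aperture α, the disc of radius ρ = (1 - |z|)/2 about z lies in the
  -- region of aperture 2|α| + 1. There Cauchy's estimate for φ - 1 - δ(ζ - 1) bounds φ'(z) - δ by
  -- ε/2.
  have hev := (Metric.tendsto_nhds.1 (h (2 * |α| + 1))) (ε / (2 * (2 * |α| + 1))) (by positivity)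
  rw [eventually_inf_principal, eventually_comap, Metric.eventually_nhds_iff] at hev
  obtain ⟨η, hη, hball⟩ := hev
  rw [eventually_inf_principal, eventually_comap, Metric.eventually_nhds_iff]
  refine ⟨η / 2, by positivity, ?_⟩
  rintro _ hy z rfl hz
  have hz : ‖(z : ℂ) - 1‖ < α * (1 - ‖(z : ℂ)‖) := hz
  rw [dist_eq_norm] at hy
  have hlt := z.norm_lt_one
  have hα : α * (1 - ‖(z : ℂ)‖) ≤ |α| * (1 - ‖(z : ℂ)‖) :=
    mul_le_mul_of_nonneg_right (le_abs_self α) (by linarith)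
  have h1z : 1 - ‖(z : ℂ)‖ ≤ ‖(z : ℂ) - 1‖ := by
    have := norm_sub_norm_le (1 : ℂ) z
    rwa [norm_one, norm_sub_rev] at this
  obtain ⟨ρ, hρ⟩ : ∃ ρ, ρ = (1 - ‖(z : ℂ)‖) / 2 := ⟨_, rfl⟩
  have hρ0 : 0 < ρ := by rw [hρ]; linarith
  have hin : ∀ ζ ∈ Metric.closedBall (z : ℂ) ρ, ‖ζ‖ < 1 := by
    intro ζ hζ
    rw [mem_closedBall_iff_norm] at hζ
    have := norm_le_norm_add_norm_sub' ζ (z : ℂ)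
    linarith
  have hg : ∀ ζ ∈ Metric.sphere (z : ℂ) ρ,
      ‖φ ζ - 1 - δ * (ζ - 1)‖ ≤ ε / 2 * ρ := by
    intro ζ hζ
    have hζ1 := norm_le_norm_add_norm_sub' ζ (z : ℂ)
    have hζ2 := norm_sub_le_norm_sub_add_norm_sub ζ (z : ℂ) 1
    rw [mem_sphere_iff_norm.1 hζ] at hζ1 hζ2
    have hζlt : ‖ζ‖ < 1 := by linarith
    have hst : ‖ζ - 1‖ < (2 * |α| + 1) * (1 - ‖ζ‖) := by
      have : (2 * |α| + 1) * ρ ≤ (2 * |α| + 1) * (1 - ‖ζ‖) := by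
        gcongr
        linarith
      have e : (2 * |α| + 1) * ρ = |α| * (1 - ‖(z : ℂ)‖) + ρ := by rw [hρ]; ring
      linarith
    have hb := hball (y := ζ) (by rw [dist_eq_norm]; linarith) (UnitDisc.mk ζ hζlt) rfl hst
    rw [UnitDisc.coe_mk, dist_eq_norm] at hb
    have hne : 1 - ζ ≠ 0 := one_sub_ne_zero (UnitDisc.mk ζ hζlt)
    have e : φ ζ - 1 - δ * (ζ - 1) = -((1 - φ ζ) / (1 - ζ) - δ) * (1 - ζ) := by
      field_simp
      ring
    rw [e, norm_mul, norm_neg, norm_sub_rev 1 ζ]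
    have e2 : ‖ζ - 1‖ ≤ (2 * |α| + 1) * ρ := by
      have e : (2 * |α| + 1) * ρ = |α| * (1 - ‖(z : ℂ)‖) + ρ := by rw [hρ]; ring
      linarith
    calc _ ≤ ε / (2 * (2 * |α| + 1)) * ((2 * |α| + 1) * ρ) := by gcongr
      _ = ε / 2 * ρ := by field_simp
  have hdiff : DifferentiableOn ℂ (fun ζ ↦ φ ζ - 1 - δ * (ζ - 1)) (Metric.ball 0 1) :=
    (hφ.sub_const 1).sub (by fun_prop)
  have hcont : DiffContOnCl ℂ (fun ζ ↦ φ ζ - 1 - δ * (ζ - 1)) (Metric.ball (z : ℂ) ρ) := by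
    refine DifferentiableOn.diffContOnCl (hdiff.mono fun ζ hζ ↦ ?_)
    have := hin ζ (Metric.closure_ball_subset_closedBall hζ)
    rwa [mem_ball_zero_iff]
  have hder := norm_deriv_le_of_forall_mem_sphere_norm_le hρ0 hcont hg
  have hφz : DifferentiableAt ℂ φ z :=
    hφ.differentiableAt (Metric.isOpen_ball.mem_nhds (by simpa using hlt))
  have hd : HasDerivAt (fun ζ ↦ φ ζ - 1 - δ * (ζ - 1)) (deriv φ z - δ * 1) z :=
    (hφz.hasDerivAt.sub_const 1).sub (((hasDerivAt_id (z : ℂ)).sub_const 1).const_mul δ)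
  rw [hd.deriv, mul_one, mul_div_assoc, div_self hρ0.ne', mul_one] at hder
  rw [dist_eq_norm]
  linarith

/-! ### An angular derivative forces linear growth -/

theorem exists_le_norm_cayley_of_deriv (hφ : DifferentiableOn ℂ φ (Metric.ball 0 1))
    (hmaps : Set.MapsTo φ (Metric.ball 0 1) (Metric.ball 0 1))
    (hφ1 : HasNontangentialLimit (fun z : 𝔻 ↦ φ z) 1 1)
    {d : ℂ} (hd : HasNontangentialLimit (fun z : 𝔻 ↦ deriv φ z) 1 d) :
    ∃ κ > 0, ∀ᶠ n : ℕ in atTop, κ * (n + 1 : ℝ) ≤ ‖cayley (φ (radial n))‖ := by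
  have hev := (hd 2).norm.eventually (gt_mem_nhds (lt_add_one ‖d‖))
  rw [eventually_inf_principal, eventually_comap, Metric.eventually_nhds_iff] at hev
  obtain ⟨η, hη, hball⟩ := hev
  set D := ‖d‖ + 1 with hD
  have hDpos : 0 < D := by positivity
  set s : Set ℂ := ofRealCLM '' Set.Ioo (max 0 (1 - η)) 1 with hs
  have hconv : Convex ℝ s := (convex_Ioo _ _).linear_image (ofRealCLM : ℝ →ₗ[ℝ] ℂ)
  have hs1 : ∀ ζ ∈ s, DifferentiableAt ℂ φ ζ ∧ ‖deriv φ ζ‖ ≤ D := by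
    rintro _ ⟨x, ⟨hx0, hx1⟩, rfl⟩
    rw [max_lt_iff] at hx0
    have hn : ‖(x : ℂ)‖ = x := by rw [norm_real, Real.norm_of_nonneg hx0.1.le]
    have hn1 : ‖(x : ℂ) - 1‖ = 1 - x := by
      rw [← ofReal_one, ← ofReal_sub, norm_real, Real.norm_eq_abs, abs_sub_comm,
        abs_of_pos (by linarith)]
    refine ⟨hφ.differentiableAt (Metric.isOpen_ball.mem_nhds ?_), ?_⟩
    · rwa [ofRealCLM_apply, mem_ball_zero_iff, hn]
    refine (hball (y := (x : ℂ)) (by rw [dist_eq_norm, hn1]; linarith)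
      (UnitDisc.mk (x : ℂ) (by rwa [hn])) rfl ?_).le
    rw [stolzRegion, Set.mem_ofPred_eq, UnitDisc.coe_mk, hn1, hn]
    linarith
  have hmem : ∀ᶠ n in atTop, (radial n : ℂ) ∈ s := by
    have h1 : Tendsto (fun n : ℕ ↦ (n : ℝ) / (n + 2)) atTop (𝓝 1) := by
      simpa using tendsto_natCast_div_add_atTop (2 : ℝ)
    filter_upwards [h1.eventually (lt_mem_nhds (max_lt one_pos (by linarith) :
      max 0 (1 - η) < 1))] with n hn
    refine ⟨(n : ℝ) / (n + 2), ⟨hn, ?_⟩, rfl⟩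
    rw [div_lt_one (by positivity)]; linarith
  have hφr := hφ1.tendsto_radial
  have hlip : ∀ᶠ n in atTop, ‖1 - φ (radial n)‖ ≤ D * ‖1 - (radial n : ℂ)‖ := by
    filter_upwards [hmem] with n hn
    -- The point 1 is outside the disc, so the mean value inequality is applied up to radial m, and
    -- m → ∞.
    refine le_of_tendsto_of_tendsto (hφr.sub_const _).norm
      ((tendsto_radial.sub_const _).norm.const_mul D) (hmem.mono fun m hm ↦ ?_)
    exact hconv.norm_image_sub_le_of_norm_deriv_le (fun ζ hζ ↦ (hs1 ζ hζ).1)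
      (fun ζ hζ ↦ (hs1 ζ hζ).2) hn hm
  have hnum : ∀ᶠ n in atTop, 1 < ‖1 + φ (radial n)‖ := by
    have := (hφr.const_add 1).norm
    refine this.eventually (lt_mem_nhds ?_)
    norm_num
  -- From |1 - radial n| = 2/(n + 2) and |1 + φ| > 1.
  refine ⟨(2 * D)⁻¹, by positivity, ?_⟩
  filter_upwards [hlip, hnum] with n h1 h2
  have h3 : ‖1 - (radial n : ℂ)‖ = 2 / (n + 2 : ℝ) := by
    rw [coe_radial, ← ofReal_one, ← ofReal_sub, norm_real]
    have : 1 - (n : ℝ) / (n + 2) = 2 / (n + 2 : ℝ) := by field_simp; ring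
    rw [this, Real.norm_of_nonneg (by positivity)]
  have h0 : 0 < ‖1 - φ (radial n)‖ :=
    norm_pos_iff.2 (one_sub_ne_zero (selfMap φ hmaps (radial n)))
  rw [h3] at h1
  rw [cayley, norm_div, le_div_iff₀ h0]
  calc (2 * D)⁻¹ * (n + 1 : ℝ) * ‖1 - φ (radial n)‖
      ≤ (2 * D)⁻¹ * (n + 2 : ℝ) * (D * (2 / (n + 2 : ℝ))) := by gcongr; norm_num
    _ = 1 := by field_simp
    _ ≤ _ := h2.le

end

end DeBrangesRovnyak

end

/-! ### The equivalence -/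

theorem mainTheorem11 (φ : ℂ → ℂ)
    (hφ : DifferentiableOn ℂ φ (Metric.ball 0 1))
    (hmaps : Set.MapsTo φ (Metric.ball 0 1) (Metric.ball 0 1))
    (hφ1 : DeBrangesRovnyak.HasNontangentialLimit (fun z : 𝔻 ↦ φ z) 1 1) :
    List.TFAE [
      ∃ u : DeBrangesRovnyak.Space (fun z ↦ (1 + z) / 2),
        (∃ c : ℂ, c ≠ 0 ∧ DeBrangesRovnyak.HasNontangentialLimit (fun z : 𝔻 ↦ u z) 1 c) ∧
        DeBrangesRovnyak.WeightedCompositionBounded (fun z ↦ (1 + z) / 2) (fun z : 𝔻 ↦ u z)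
          (DeBrangesRovnyak.selfMap φ hmaps),
      DeBrangesRovnyak.HasAngularDerivative φ 1,
      DeBrangesRovnyak.CompositionBounded (fun z ↦ (1 + z) / 2)
        (DeBrangesRovnyak.selfMap φ hmaps)] := by
  tfae_have 1 → 2 := by
    rintro ⟨u, ⟨c, hc, hu⟩, hW⟩
    obtain ⟨κ, hκ, h⟩ := DeBrangesRovnyak.exists_le_norm_cayley_of_weighted hc hu.tendsto_radial
      (φ := DeBrangesRovnyak.selfMap φ hmaps) hφ1.tendsto_radial hW
    obtain ⟨δ, hδ⟩ := DeBrangesRovnyak.exists_tendsto_quotient hφ hmaps hφ1 hκ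
      (DeBrangesRovnyak.julia hφ hmaps h)
    exact ⟨⟨1, norm_one, hφ1⟩, δ, DeBrangesRovnyak.hasNontangentialLimit_deriv hφ hδ⟩
  tfae_have 2 → 3 := by
    rintro ⟨-, d, hd⟩
    obtain ⟨κ, hκ, h⟩ := DeBrangesRovnyak.exists_le_norm_cayley_of_deriv hφ hmaps hφ1 hd
    exact DeBrangesRovnyak.compositionBounded_of_julia hφ hmaps hκ
      (DeBrangesRovnyak.julia hφ hmaps h)
  tfae_have 3 → 1 := by
    rintro ⟨C, hC⟩
    obtain ⟨e, -, he⟩ := DeBrangesRovnyak.exists_boundaryKernel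
    -- The boundary kernel shows that constants lie in the space; the constant weight 1/2 just
    -- rescales C.
    refine ⟨e, ⟨1 / 2, by norm_num, fun α ↦ ?_⟩, (1 / 2 : ℂ) • C, fun f z ↦ ?_⟩
    · simp only [he]
      exact tendsto_const_nhds
    · simp only [he]
      rw [smul_apply, RKHS.coe_smul, Pi.smul_apply, hC, smul_eq_mul]
  tfae_finish
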